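/- Let $V,E$ be finite index sets and let $P=\mathrm{conv}(\{v^i\}_{i\in V})+\mathrm{cone}(\{r^j\}_{j\in E})\subseteq\mathbb R^n$ be a rational polyhedron, where the $v^i\in\mathbb Q^n$ $(i\in V)$ are the pairwise distinct vertices of $P$ and the $r^j\in\mathbb Z^n$ $(j\in E)$ generate its pairwise distinct extreme rays. For $\delta\in\mathbb R^n$ and $\delta_0\in\mathbb R$, let $V^c(\delta,\delta_0):=\{i\in V:\delta^Tv^i<\delta_0\}$. The inequality $\delta^Tx\ge\delta_0$ is called a non-negative cut for $P$ if $V^c(\delta,\delta_0)\neq\emptyset$ and $\delta^Tr^j\ge 0$ for all $j\in E$. Let $\{(\delta^l)^Tx\ge\delta^l_0\}_{l\in I}$ be a (possibly infinite) family of non-negative cuts for $P$, and suppose that $V^c\subseteq V$ satisfies $V^c(\delta^l,\delta^l_0)=V^c$ for all $l\in I$. For $i\in V^c$, $j\in E$, $k\in V\setminus V^c$ and $l\in I$ define $$\alpha'_{i,j,l}:=\begin{cases}\dfrac{\delta^l_0-(\delta^l)^Tv^i}{(\delta^l)^Tr^j}&\text{if }(\delta^l)^Tr^j>0,\\ +\infty&\text{otherwise,}\end{cases}\qquad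 \beta'_{i,k,l}:=\frac{\delta^l_0-(\delta^l)^Tv^i}{(\delta^l)^T(v^k-v^i)}\in\,]0,1],$$ the parameters at which the halfline $\{v^i+\alpha r^j:\alpha\ge0\}$ and the segment from $v^i$ to $v^k$ meet the hyperplane $(\delta^l)^Tx=\delta^l_0$. Assume that 1. for every $\alpha^*>0$ and all $(i,j)\in V^c\times E$, the set of values $\{\alpha'_{i,j,l}: l\in I,\ \alpha'_{i,j,l}\ge\alpha^*\}$ is finite; 2. for every $\beta^*\in\,]0,1]$ and all $(i,k)\in V^c\times(V\setminus V^c)$, the set of values $\{\beta'_{i,k,l}: l\in I,\ \beta'_{i,k,l}\ge\beta^*\}$ is finite. Then $X:=\{x\in P:(\delta^l)^Tx\ge\delta^l_0\text{ for all }l\in I\}$ is a polyhedron, i.e. the solution set of finitely many linear inequalities. -/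

import Mathlib

open scoped Pointwise

noncomputable section

/-- The cone `{∑ j, μ j • r j : μ ≥ 0}` generated by a finite family of vectors. -/
def finCone {n : ℕ} {E : Type*} [Fintype E] (r : E → Fin n → ℝ) : Set (Fin n → ℝ) :=
  {x | ∃ μ : E → ℝ, (∀ j, 0 ≤ μ j) ∧ x = ∑ j, μ j • r j}

/-- The set `conv {v i} + cone {r j}` (a Minkowski sum). -/
def innerPoly {n : ℕ} {V E : Type*} [Fintype E] (v : V → Fin n → ℝ) (r : E → Fin n → ℝ) :
    Set (Fin n → ℝ) :=
  convexHull ℝ (Set.range v) + finCone r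

/-- The vector `d` generates an extreme ray of the convex cone `C`: it is a nonzero element of `C`,
and in every decomposition of `d` inside `C` the summands are nonnegative multiples of `d`
(the condition is imposed on `a`; by commutativity of addition it covers `b` as well). -/
def GeneratesExtremeRay {n : ℕ} (C : Set (Fin n → ℝ)) (d : Fin n → ℝ) : Prop :=
  d ∈ C ∧ d ≠ 0 ∧ ∀ a ∈ C, ∀ b ∈ C, a + b = d → ∃ s : ℝ, 0 ≤ s ∧ a = s • d

/-- `v` lists the vertices (each one once) and `r` lists the extreme rays (one generator for each)
of the rational polyhedron `P = conv {v i} + cone {r j}`, with `v i ∈ ℚⁿ` and `r j ∈ ℤⁿ`.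
The extreme rays of `P` are those of its recession cone, which is `cone {r j}`. -/
structure IsVertexRayRep {n : ℕ} {V E : Type*} [Fintype E]
    (v : V → Fin n → ℝ) (r : E → Fin n → ℝ) : Prop where
  rational : ∀ i c, ∃ q : ℚ, v i c = q
  integral : ∀ j c, ∃ z : ℤ, r j c = z
  injective : Function.Injective v
  vertices : Set.range v = Set.extremePoints ℝ (innerPoly v r)
  extreme : ∀ j, GeneratesExtremeRay (finCone r) (r j)
  distinct : ∀ j j', SameRay ℝ (r j) (r j') → j = j'

/-- The index set of the vertices that violate the inequality `δᵀ x ≥ δ₀`. -/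
def cutOffVertices {n : ℕ} {V : Type*} (v : V → Fin n → ℝ) (δ : Fin n → ℝ) (δ₀ : ℝ) : Set V :=
  {i | δ ⬝ᵥ v i < δ₀}

/-- `δᵀ x ≥ δ₀` is a non-negative cut: it cuts off at least one vertex, and `δᵀ rʲ ≥ 0` for all
extreme rays. -/
def IsNonnegCut {n : ℕ} {V E : Type*} (v : V → Fin n → ℝ) (r : E → Fin n → ℝ)
    (δ : Fin n → ℝ) (δ₀ : ℝ) : Prop :=
  (cutOffVertices v δ δ₀).Nonempty ∧ ∀ j, 0 ≤ δ ⬝ᵥ r j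

open Classical in
/-- The parameter `α` at which the halfline `{p + α d : α ≥ 0}`, whose origin `p` violates
`δᵀ x ≥ δ₀`, meets the hyperplane `δᵀ x = δ₀`; it is `+∞` if `δᵀ d ≤ 0`. -/
def alphaPrime {n : ℕ} (δ : Fin n → ℝ) (δ₀ : ℝ) (p d : Fin n → ℝ) : EReal :=
  if 0 < δ ⬝ᵥ d then (((δ₀ - δ ⬝ᵥ p) / (δ ⬝ᵥ d) : ℝ) : EReal) else ⊤

open Classical in
/-- The parameter `β` at which the segment from a point `p` violating `δᵀ x ≥ δ₀` to a point `w`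
satisfying it meets the hyperplane `δᵀ x = δ₀`; it is `+∞` if `w` violates the inequality. -/
def betaPrime {n : ℕ} (δ : Fin n → ℝ) (δ₀ : ℝ) (p w : Fin n → ℝ) : EReal :=
  if δ₀ ≤ δ ⬝ᵥ w then (((δ₀ - δ ⬝ᵥ p) / (δ ⬝ᵥ (w - p)) : ℝ) : EReal) else ⊤

/-- A polyhedron is the solution set of finitely many linear inequalities. -/
def IsPolyhedron {n : ℕ} (S : Set (Fin n → ℝ)) : Prop :=
  ∃ (m : ℕ) (A : Matrix (Fin m) (Fin n) ℝ) (b : Fin m → ℝ), S = {x | A.mulVec x ≤ b}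

end

/-! All cuts violate the same vertices, so on P they can be compared through their intersection
parameters: a cut whose parameters are all at least those of another implies it
(`le_dotProduct_of_alphaPrime_le_of_betaPrime_le`). By the finiteness hypotheses each parameter is
well-ordered downwards from above, so by Dickson's lemma the parameter vectors, ordered in reverse,
are partially well-ordered. Hence finitely many cuts dominate the whole family
(`Set.IsPWO.exists_finite_basis`). Added to a finite description of P (`isPolyhedron_innerPoly`),
they describe X. -/

/-! ### Finitely generated cones are polyhedral -/

/-- A set cut out of a real vector space by finitely many homogeneous linear inequalities. -/
def IsPolyhedralCone {W : Type*} [AddCommGroup W] [Module ℝ W] (S : Set W) : Prop :=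
  ∃ s : Set (Module.Dual ℝ W), s.Finite ∧ ∀ x, x ∈ S ↔ ∀ a ∈ s, a x ≤ 0

theorem isPolyhedralCone_zero {W : Type*} [AddCommGroup W] [Module ℝ W] [FiniteDimensional ℝ W] :
    IsPolyhedralCone ({0} : Set W) := by
  let B := Module.finBasis ℝ W
  refine ⟨Set.range B.coord ∪ Set.range (fun i => -B.coord i),
    (Set.finite_range _).union (Set.finite_range _), fun x => ⟨?_, fun h => ?_⟩⟩
  · rintro rfl a -
    simp
  · refine (B.forall_coord_eq_zero_iff).1 fun i => le_antisymm (h _ (Or.inl ⟨i, rfl⟩)) ?_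
    simpa using h _ (Or.inr ⟨i, rfl⟩)

/-- Fourier–Motzkin elimination of a single nonnegative parameter. -/
theorem exists_nonneg_forall_le_mul_iff {W : Type*} [AddCommGroup W] [Module ℝ W]
    {s : Set (Module.Dual ℝ W)} (hs : s.Finite) (g y : W) :
    (∃ μ : ℝ, 0 ≤ μ ∧ ∀ a ∈ s, a (y - μ • g) ≤ 0) ↔
      (∀ a ∈ s, a g ≤ 0 → a y ≤ 0) ∧
        ∀ a ∈ s, ∀ b ∈ s, 0 < a g → b g < 0 → a g * b y - b g * a y ≤ 0 := by
  simp only [map_sub, map_smul, smul_eq_mul, sub_nonpos]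
  constructor
  · rintro ⟨μ, hμ, h⟩
    refine ⟨fun a ha hg => (h a ha).trans (mul_nonpos_of_nonneg_of_nonpos hμ hg),
      fun a ha b hb hag hbg => ?_⟩
    have h1 := mul_le_mul_of_nonneg_left (h b hb) hag.le
    have h2 := mul_le_mul_of_nonpos_left (h a ha) hbg.le
    linarith
  · rintro ⟨h0, h1⟩
    -- Rows with `a g > 0` bound `μ` from below, rows with `b g < 0` from above.
    have key : ∀ a ∈ {a ∈ s | 0 < a g}, ∀ b ∈ {b ∈ s | b g < 0}, a y / a g ≤ b y / b g := by
      rintro a ⟨ha, hag⟩ b ⟨hb, hbg⟩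
      rw [div_le_iff₀ hag, div_mul_eq_mul_div, le_div_iff_of_neg hbg]
      linarith [h1 a ha b hb hag hbg]
    obtain ⟨μ, hμ, hμ'⟩ : ∃ μ : ℝ, (0 ≤ μ ∧ ∀ a ∈ s, 0 < a g → a y / a g ≤ μ) ∧
        ∀ b ∈ s, b g < 0 → μ ≤ b y / b g := by
      rcases Set.eq_empty_or_nonempty {a ∈ s | 0 < a g} with he | hne
      · refine ⟨0, ⟨le_rfl, fun a ha hag => ?_⟩, fun b hb hbg =>
          div_nonneg_of_nonpos (h0 b hb hbg.le) hbg.le⟩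
        exact (Set.notMem_empty a (he ▸ ⟨ha, hag⟩)).elim
      · obtain ⟨a, ha, hmax⟩ := Set.exists_max_image _ (fun a : Module.Dual ℝ W => a y / a g)
          (hs.subset (Set.sep_subset s _)) hne
        refine ⟨max 0 (a y / a g), ⟨le_max_left _ _, fun a' ha' hag' =>
          (hmax a' ⟨ha', hag'⟩).trans (le_max_right _ _)⟩, fun b hb hbg => max_le
            (div_nonneg_of_nonpos (h0 b hb hbg.le) hbg.le) (key a ha b ⟨hb, hbg⟩)⟩
    refine ⟨μ, hμ.1, fun a ha => ?_⟩
    rcases lt_trichotomy (a g) 0 with hg | hg | hg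
    · exact (le_div_iff_of_neg hg).1 (hμ' a ha hg)
    · rw [hg, mul_zero]
      exact h0 a ha hg.le
    · exact (div_le_iff₀ hg).1 (hμ.2 a ha hg)

theorem IsPolyhedralCone.add_ray {W : Type*} [AddCommGroup W] [Module ℝ W] {S : Set W}
    (hS : IsPolyhedralCone S) (g : W) :
    IsPolyhedralCone {y | ∃ μ : ℝ, 0 ≤ μ ∧ y - μ • g ∈ S} := by
  obtain ⟨s, hs, hmem⟩ := hS
  refine ⟨{a ∈ s | a g ≤ 0} ∪ Set.image2 (fun a b : Module.Dual ℝ W => a g • b - b g • a)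
    {a ∈ s | 0 < a g} {b ∈ s | b g < 0}, (hs.subset (Set.sep_subset _ _)).union
      ((hs.subset (Set.sep_subset _ _)).image2 _ (hs.subset (Set.sep_subset _ _))), fun y => ?_⟩
  simp only [Set.mem_ofPred_eq, hmem]
  rw [exists_nonneg_forall_le_mul_iff hs]
  constructor
  · rintro ⟨h0, h1⟩ c (⟨ha, hag⟩ | ⟨a, ⟨ha, hag⟩, b, ⟨hb, hbg⟩, rfl⟩)
    · exact h0 c ha hag
    · simpa using h1 a ha b hb hag hbg
  · intro h
    refine ⟨fun a ha hag => h a (Or.inl ⟨ha, hag⟩), fun a ha b hb hag hbg => ?_⟩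
    simpa using h _ (Or.inr ⟨a, ⟨ha, hag⟩, b, ⟨hb, hbg⟩, rfl⟩)

/-- **Minkowski–Weyl** for cones: a finitely generated cone is polyhedral. -/
theorem isPolyhedralCone_setOf_sum {W ι : Type*} [AddCommGroup W] [Module ℝ W]
    [FiniteDimensional ℝ W] (t : Finset ι) (g : ι → W) :
    IsPolyhedralCone {x | ∃ μ : ι → ℝ, (∀ i, 0 ≤ μ i) ∧ x = ∑ i ∈ t, μ i • g i} := by
  classical
  induction t using Finset.induction_on with
  | empty =>
    convert isPolyhedralCone_zero (W := W) using 1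
    ext x
    simp only [Finset.sum_empty, Set.mem_ofPred_eq, Set.mem_singleton_iff]
    exact ⟨fun ⟨_, _, h⟩ => h, fun h => ⟨0, fun _ => le_rfl, h⟩⟩
  | insert i t hi ih =>
    convert ih.add_ray (g i) using 1
    ext x
    simp only [Set.mem_ofPred_eq, Finset.sum_insert hi]
    constructor
    · rintro ⟨μ, hμ, rfl⟩
      exact ⟨μ i, hμ i, μ, hμ, by abel⟩
    · rintro ⟨m, hm, μ, hμ, h⟩
      -- The old value of `μ` at `i ∉ t` is irrelevant to the sum over `t`.
      refine ⟨Function.update μ i m, fun j => ?_, ?_⟩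
      · rcases eq_or_ne j i with rfl | hj
        · simpa using hm
        · simpa [hj] using hμ j
      · rw [sub_eq_iff_eq_add'] at h
        rw [h, Function.update_self]
        congr 1
        refine Finset.sum_congr rfl fun j hj => ?_
        rw [Function.update_of_ne (ne_of_mem_of_not_mem hj hi)]

/-! ### Polyhedra -/

theorem isPolyhedron_of_finite {n : ℕ} {ι : Type*} [Finite ι] (a : ι → Fin n → ℝ) (b : ι → ℝ) :
    IsPolyhedron {x | ∀ i, a i ⬝ᵥ x ≤ b i} := by
  obtain ⟨m, ⟨e⟩⟩ := Finite.exists_equiv_fin ι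
  refine ⟨m, Matrix.of fun i => a (e.symm i), fun i => b (e.symm i), ?_⟩
  ext x
  simp only [Set.mem_ofPred_eq, Pi.le_def, Matrix.mulVec, Matrix.of_apply]
  exact e.symm.forall_congr_right.symm

theorem IsPolyhedron.inter {n : ℕ} {S T : Set (Fin n → ℝ)} (hS : IsPolyhedron S)
    (hT : IsPolyhedron T) : IsPolyhedron (S ∩ T) := by
  obtain ⟨m, A, b, rfl⟩ := hS
  obtain ⟨k, B, c, rfl⟩ := hT
  convert isPolyhedron_of_finite (Sum.elim (fun i => A i) (fun i => B i)) (Sum.elim b c) using 1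
  ext x
  simp [Sum.forall, Pi.le_def, Matrix.mulVec]

theorem mem_convexHull_range_iff {W ι : Type*} [AddCommGroup W] [Module ℝ W] [Fintype ι]
    (v : ι → W) (x : W) :
    x ∈ convexHull ℝ (Set.range v) ↔
      ∃ w : ι → ℝ, (∀ i, 0 ≤ w i) ∧ ∑ i, w i = 1 ∧ x = ∑ i, w i • v i := by
  classical
  have h : Set.range v =
      Fintype.linearCombination ℝ v '' Set.range fun i : ι => Pi.single i (1 : ℝ) := by
    rw [← Set.range_comp]
    congr 1
    ext i
    simp [Fintype.linearCombination_apply_single]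
  rw [h, ← LinearMap.image_convexHull, convexHull_rangle_single_eq_stdSimplex]
  simp only [Set.mem_image, stdSimplex, Set.mem_ofPred_eq, Fintype.linearCombination_apply,
    and_assoc, eq_comm]

/-- **Minkowski–Weyl**: the sum of a polytope and a finitely generated cone is a polyhedron. -/
theorem isPolyhedron_innerPoly {n : ℕ} {V E : Type*} [Fintype V] [Fintype E]
    (v : V → Fin n → ℝ) (r : E → Fin n → ℝ) : IsPolyhedron (innerPoly v r) := by
  -- Homogenization: with vertices at height 1 and rays at height 0, the polyhedron is the slice of
  -- a cone at height 1.
  obtain ⟨s, hs, hmem⟩ := isPolyhedralCone_setOf_sum (Finset.univ : Finset (V ⊕ E))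
    (Sum.elim (fun i => (v i, (1 : ℝ))) fun j => (r j, 0))
  have := hs.to_subtype
  convert isPolyhedron_of_finite (fun (a : s) c => a.1 (Pi.single c 1, 0))
    (fun a => -a.1 (0, 1)) using 1
  ext x
  have hx : ∀ a : Module.Dual ℝ ((Fin n → ℝ) × ℝ),
      (fun c => a (Pi.single c 1, 0)) ⬝ᵥ x = a (x, 1) - a (0, 1) := by
    intro a
    rw [← map_sub, Prod.mk_sub_mk, sub_zero, sub_self]
    have := LinearMap.pi_apply_eq_sum_univ (a ∘ₗ LinearMap.inl ℝ (Fin n → ℝ) ℝ) x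
    simp only [LinearMap.comp_apply, LinearMap.inl_apply, smul_eq_mul] at this
    rw [this]
    simp only [dotProduct, mul_comm]
    refine Finset.sum_congr rfl fun c _ => ?_
    congr 3
    ext d
    simp [Pi.single_apply, eq_comm]
  trans (x, (1 : ℝ)) ∈ {x | ∃ μ : V ⊕ E → ℝ, (∀ i, 0 ≤ μ i) ∧
      x = ∑ i, μ i • Sum.elim (fun i => (v i, (1 : ℝ))) (fun j => (r j, 0)) i}
  · simp only [innerPoly, Set.mem_add, mem_convexHull_range_iff, finCone, Set.mem_ofPred_eq,
      Fintype.sum_sum_type, Sum.elim_inl, Sum.elim_inr, Prod.ext_iff, Prod.fst_add, Prod.snd_add,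
      Prod.fst_sum, Prod.snd_sum, Prod.smul_fst, Prod.smul_snd, smul_eq_mul, mul_one, mul_zero,
      Finset.sum_const_zero, add_zero]
    constructor
    · rintro ⟨_, ⟨w, hw, hw1, rfl⟩, _, ⟨μ, hμ, rfl⟩, rfl⟩
      exact ⟨Sum.elim w μ, Sum.forall.2 ⟨hw, hμ⟩, rfl, hw1.symm⟩
    · rintro ⟨μ, hμ, hx, h1⟩
      exact ⟨_, ⟨fun i => μ (Sum.inl i), fun i => hμ _, h1.symm, rfl⟩, _,
        ⟨fun j => μ (Sum.inr j), fun j => hμ _, rfl⟩, hx.symm⟩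
  · rw [hmem]
    simp only [Set.mem_ofPred_eq, Subtype.forall, hx]
    exact forall₂_congr fun a _ => ⟨fun h => by linarith, fun h => by linarith⟩

theorem le_dotProduct_of_mem_innerPoly {n : ℕ} {V E : Type*} [Fintype E]
    {v : V → Fin n → ℝ} {r : E → Fin n → ℝ} {d : Fin n → ℝ} {c : ℝ}
    (hv : ∀ i, c ≤ d ⬝ᵥ v i) (hr : ∀ j, 0 ≤ d ⬝ᵥ r j) {x : Fin n → ℝ}
    (hx : x ∈ innerPoly v r) : c ≤ d ⬝ᵥ x := by
  obtain ⟨p, hp, _, ⟨μ, hμ, rfl⟩, rfl⟩ := hx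
  have hp' : c ≤ d ⬝ᵥ p := by
    refine convexHull_min (t := {p | c ≤ d ⬝ᵥ p}) ?_ ?_ hp
    · rintro _ ⟨i, rfl⟩
      exact hv i
    · exact convex_halfSpace_ge (f := fun p => d ⬝ᵥ p)
        ⟨fun x y => dotProduct_add d x y, fun a x => dotProduct_smul a d x⟩ c
  have hq : 0 ≤ d ⬝ᵥ ∑ j, μ j • r j := by
    rw [dotProduct_sum]
    exact Finset.sum_nonneg fun j _ => by
      rw [dotProduct_smul]
      exact mul_nonneg (hμ j) (hr j)
  rw [dotProduct_add]
  linarith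

/-! ### Finite bases of well-quasi-ordered families -/

/-- The minimal values form an antichain, hence a finite set, and every value lies above one of
them. -/
theorem Set.IsPWO.exists_finite_basis {I α : Type*} [PartialOrder α] {F : I → α}
    (hF : (Set.range F).IsPWO) : ∃ T : Set I, T.Finite ∧ ∀ l, ∃ l' ∈ T, F l' ≤ F l := by
  have hfin : {a | Minimal (· ∈ Set.range F) a}.Finite :=
    (setOfPred_minimal_antichain _).finite_of_partiallyWellOrderedOn
      (hF.mono fun a ha => ha.prop)
  choose g hg using fun a : {a // Minimal (· ∈ Set.range F) a} => a.2.prop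
  have : Finite {a // Minimal (· ∈ Set.range F) a} := hfin
  refine ⟨Set.range g, Set.finite_range g, fun l => ?_⟩
  obtain ⟨b, hb, hmin⟩ := hF.exists_le_minimal ⟨l, rfl⟩
  exact ⟨g ⟨b, hmin⟩, ⟨_, rfl⟩, (hg ⟨b, hmin⟩).trans_le hb⟩

theorem isPWO_orderDual_of_finite_ge {α : Type*} [LinearOrder α] {S : Set αᵒᵈ}
    (hS : ∀ a ∈ S, {b ∈ S | b ≤ a}.Finite) : S.IsPWO := by
  rw [Set.isPWO_iff_isWF, Set.isWF_iff_no_descending_seq]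
  intro f hf hmem
  refine Set.infinite_range_of_injective hf.injective ((hS (f 0) (hmem 0)).subset ?_)
  rintro _ ⟨k, rfl⟩
  exact ⟨hmem k, hf.antitone (Nat.zero_le k)⟩

/-! ### Domination of cuts -/

/-- Cross-multiplied so that it also covers directions with zero slope, where the parameter is `⊤`.
-/
theorem mul_le_mul_of_alphaPrime_le {n : ℕ} {δ δ' : Fin n → ℝ} {c c' : ℝ} {p d : Fin n → ℝ}
    (hp' : δ' ⬝ᵥ p < c') (hd : 0 ≤ δ ⬝ᵥ d) (hd' : 0 ≤ δ' ⬝ᵥ d)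
    (h : alphaPrime δ c p d ≤ alphaPrime δ' c' p d) :
    δ' ⬝ᵥ d * (c - δ ⬝ᵥ p) ≤ δ ⬝ᵥ d * (c' - δ' ⬝ᵥ p) := by
  rcases hd'.eq_or_lt with h0 | hpos'
  · rw [← h0, zero_mul]
    exact mul_nonneg hd (sub_pos.2 hp').le
  · rw [alphaPrime, alphaPrime, if_pos hpos'] at h
    split_ifs at h with hpos
    · rw [EReal.coe_le_coe_iff, div_le_div_iff₀ hpos hpos'] at h
      linarith
    · exact absurd h (not_le.2 (EReal.coe_lt_top _))

/-- Each parameter is `s / (s + t)`, with `s` the violation at `p` and `t` the slack at `w`, so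
comparing parameters amounts to comparing the ratios `s / t` after cross-multiplication. -/
theorem mul_le_mul_of_betaPrime_le {n : ℕ} {δ δ' : Fin n → ℝ} {c c' : ℝ} {p w : Fin n → ℝ}
    (hp : δ ⬝ᵥ p < c) (hp' : δ' ⬝ᵥ p < c') (hw : c ≤ δ ⬝ᵥ w) (hw' : c' ≤ δ' ⬝ᵥ w)
    (h : betaPrime δ c p w ≤ betaPrime δ' c' p w) :
    (δ' ⬝ᵥ w - c') * (c - δ ⬝ᵥ p) ≤ (δ ⬝ᵥ w - c) * (c' - δ' ⬝ᵥ p) := by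
  rw [betaPrime, betaPrime, if_pos hw, if_pos hw', EReal.coe_le_coe_iff, dotProduct_sub,
    dotProduct_sub, div_le_div_iff₀ (by linarith) (by linarith)] at h
  linarith

/-- If all intersection parameters of the cut `(δ, c)` are at most those of `(δ', c')`, then
`(δ', c')` implies `(δ, c)` on `innerPoly v r`. -/
theorem le_dotProduct_of_alphaPrime_le_of_betaPrime_le {n : ℕ} {V E : Type*} [Finite V] [Fintype E]
    {v : V → Fin n → ℝ} {r : E → Fin n → ℝ} {δ δ' : Fin n → ℝ} {c c' : ℝ} {Vc : Set V}
    (hcut : IsNonnegCut v r δ c) (hcut' : IsNonnegCut v r δ' c')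
    (hVc : cutOffVertices v δ c = Vc) (hVc' : cutOffVertices v δ' c' = Vc)
    (hα : ∀ i ∈ Vc, ∀ j, alphaPrime δ c (v i) (r j) ≤ alphaPrime δ' c' (v i) (r j))
    (hβ : ∀ i ∈ Vc, ∀ k ∉ Vc, betaPrime δ c (v i) (v k) ≤ betaPrime δ' c' (v i) (v k))
    {x : Fin n → ℝ} (hx : x ∈ innerPoly v r) (hx' : c' ≤ δ' ⬝ᵥ x) : c ≤ δ ⬝ᵥ x := by
  have hmem : ∀ i, i ∈ Vc ↔ δ ⬝ᵥ v i < c := fun i => by rw [← hVc]; rfl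
  have hmem' : ∀ i, i ∈ Vc ↔ δ' ⬝ᵥ v i < c' := fun i => by rw [← hVc']; rfl
  -- Let `M` be the largest ratio of violations. Then `(δ, c) - M • (δ', c')` is valid on P: at
  -- cut-off vertices by maximality, at the other vertices and along rays by the parameters at `i₀`.
  obtain ⟨i₀, hi₀, hmax⟩ := Set.exists_max_image Vc
    (fun i => (c - δ ⬝ᵥ v i) / (c' - δ' ⬝ᵥ v i)) Vc.toFinite (hVc ▸ hcut.1)
  have hs := sub_pos.2 ((hmem i₀).1 hi₀)
  have hs' := sub_pos.2 ((hmem' i₀).1 hi₀)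
  obtain ⟨M, hM⟩ : ∃ M, M = (c - δ ⬝ᵥ v i₀) / (c' - δ' ⬝ᵥ v i₀) := ⟨_, rfl⟩
  have hM0 : 0 ≤ M := hM ▸ (div_pos hs hs').le
  have key : ∀ y z, z * (c - δ ⬝ᵥ v i₀) ≤ y * (c' - δ' ⬝ᵥ v i₀) → M * z ≤ y := by
    intro y z h
    rw [hM, div_mul_eq_mul_div, div_le_iff₀ hs']
    linarith
  have h := le_dotProduct_of_mem_innerPoly (d := δ - M • δ') (c := c - M * c') (v := v) (r := r)
    (fun i => ?_) (fun j => ?_) hx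
  · rw [sub_dotProduct, smul_dotProduct, smul_eq_mul] at h
    nlinarith [mul_le_mul_of_nonneg_left hx' hM0]
  · rw [sub_dotProduct, smul_dotProduct, smul_eq_mul]
    by_cases hi : i ∈ Vc
    · have := hmax i hi
      rw [← hM, div_le_iff₀ (sub_pos.2 ((hmem' i).1 hi))] at this
      linarith
    · have := key _ _ (mul_le_mul_of_betaPrime_le ((hmem i₀).1 hi₀) ((hmem' i₀).1 hi₀)
        (not_lt.1 (mt (hmem i).2 hi)) (not_lt.1 (mt (hmem' i).2 hi)) (hβ i₀ hi₀ i hi))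
      linarith
  · rw [sub_dotProduct, smul_dotProduct, smul_eq_mul, sub_nonneg]
    exact key _ _ (mul_le_mul_of_alphaPrime_le ((hmem' i₀).1 hi₀)
      (hcut.2 j) (hcut'.2 j) (hα i₀ hi₀ j))

theorem exists_pos_coe_le_alphaPrime {n : ℕ} {δ : Fin n → ℝ} {c : ℝ} {p d : Fin n → ℝ}
    (hp : δ ⬝ᵥ p < c) : ∃ t : ℝ, 0 < t ∧ (t : EReal) ≤ alphaPrime δ c p d := by
  rw [alphaPrime]
  split_ifs with h
  · exact ⟨_, div_pos (sub_pos.2 hp) h, le_rfl⟩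
  · exact ⟨1, one_pos, le_top⟩

theorem exists_pos_le_one_coe_le_betaPrime {n : ℕ} {δ : Fin n → ℝ} {c : ℝ} {p w : Fin n → ℝ}
    (hp : δ ⬝ᵥ p < c) (hw : c ≤ δ ⬝ᵥ w) :
    ∃ t : ℝ, 0 < t ∧ t ≤ 1 ∧ (t : EReal) ≤ betaPrime δ c p w := by
  rw [betaPrime, if_pos hw, dotProduct_sub]
  have h : 0 < δ ⬝ᵥ w - δ ⬝ᵥ p := by linarith
  exact ⟨_, div_pos (sub_pos.2 hp) h, (div_le_one h).2 (by linarith), le_rfl⟩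

theorem theorem1 {n : ℕ} {V E I : Type*} [Fintype V] [Fintype E]
    (v : V → Fin n → ℝ) (r : E → Fin n → ℝ) (hP : IsVertexRayRep v r)
    (δ : I → Fin n → ℝ) (δ₀ : I → ℝ)
    (hcut : ∀ l, IsNonnegCut v r (δ l) (δ₀ l))
    (Vc : Set V) (hVc : ∀ l, cutOffVertices v (δ l) (δ₀ l) = Vc)
    (hα : ∀ αs : ℝ, 0 < αs → ∀ i ∈ Vc, ∀ j : E,
      {a : EReal | (αs : EReal) ≤ a ∧ ∃ l, a = alphaPrime (δ l) (δ₀ l) (v i) (r j)}.Finite)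
    (hβ : ∀ βs : ℝ, 0 < βs → βs ≤ 1 → ∀ i ∈ Vc, ∀ k ∉ Vc,
      {a : EReal | (βs : EReal) ≤ a ∧ ∃ l, a = betaPrime (δ l) (δ₀ l) (v i) (v k)}.Finite) :
    IsPolyhedron {x | x ∈ innerPoly v r ∧ ∀ l, δ₀ l ≤ δ l ⬝ᵥ x} := by
  have hmem : ∀ l i, i ∈ Vc ↔ δ l ⬝ᵥ v i < δ₀ l := fun l i => by rw [← hVc l]; rfl
  -- Dual order: minimal elements are the largest parameters, i.e. the strongest cuts.
  let F : I → (Vc × E) ⊕ (Vc × ↥Vcᶜ) → ERealᵒᵈ := fun l => Sum.elim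
    (fun q => OrderDual.toDual (alphaPrime (δ l) (δ₀ l) (v q.1) (r q.2)))
    (fun q => OrderDual.toDual (betaPrime (δ l) (δ₀ l) (v q.1) (v q.2)))
  have hF : (Set.range F).IsPWO := by
    refine (Set.IsPWO.pi (s := fun q => Set.range fun l => F l q) ?_).mono ?_
    · rintro (⟨⟨i, hi⟩, j⟩ | ⟨⟨i, hi⟩, k, hk⟩) <;> refine isPWO_orderDual_of_finite_ge ?_
      · rintro _ ⟨l, rfl⟩
        obtain ⟨t, ht, hle⟩ := exists_pos_coe_le_alphaPrime (d := r j) ((hmem l i).1 hi)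
        refine (hα t ht i hi j).subset ?_
        rintro _ ⟨⟨l', rfl⟩, hl'⟩
        exact ⟨hle.trans hl', l', rfl⟩
      · rintro _ ⟨l, rfl⟩
        obtain ⟨t, ht, ht1, hle⟩ := exists_pos_le_one_coe_le_betaPrime ((hmem l i).1 hi)
          (not_lt.1 (mt (hmem l k).2 hk))
        refine (hβ t ht ht1 i hi k hk).subset ?_
        rintro _ ⟨⟨l', rfl⟩, hl'⟩
        exact ⟨hle.trans hl', l', rfl⟩
    · rintro _ ⟨l, rfl⟩ q -
      exact ⟨l, rfl⟩
  obtain ⟨T, hT, hdom⟩ := hF.exists_finite_basis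
  have := hT.to_subtype
  convert (isPolyhedron_innerPoly v r).inter
    (isPolyhedron_of_finite (fun l : T => -δ l) (fun l => -δ₀ l)) using 1
  ext x
  simp only [Set.mem_ofPred_eq, Set.mem_inter_iff, neg_dotProduct, neg_le_neg_iff]
  refine and_congr_right fun hx => ⟨fun h l => h l, fun h l => ?_⟩
  obtain ⟨l', hl', hle⟩ := hdom l
  exact le_dotProduct_of_alphaPrime_le_of_betaPrime_le (hcut l) (hcut l') (hVc l) (hVc l')
    (fun i hi j => hle (Sum.inl (⟨i, hi⟩, j))) (fun i hi k hk => hle (Sum.inr (⟨i, hi⟩, ⟨k, hk⟩)))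
    hx (h ⟨l', hl'⟩)
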